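/- Let $K$ be a number field with algebraic closure $\overline{K}$, let $K^{\mathrm{ab}}\subseteq\overline K$ be the maximal abelian extension of $K$, let $d\ge 2$ be an integer, and let $a,c,\alpha\in K$ with $a\neq 0$. Put $f=ax^d+c$ and suppose that $0$ is periodic under $f$, i.e. $f^{n}(0)=0$ for some $n\ge 1$. Let $T_\infty(f,\alpha)=\bigcup_{n\ge 0}f^{-n}(\alpha)\subseteq\overline{K}$, let $K_\infty(f,\alpha)=K(T_\infty(f,\alpha))$ and $G_\infty(f,\alpha)=\mathrm{Gal}(K_\infty(f,\alpha)/K)$. For a field $K\subseteq L\subseteq\overline K$, call pairs $(f,\alpha)$ and $(g,\beta)$ $L$-conjugate if there is $m=ux+v$ with $u,v\in L$, $u\ne 0$, such that $g=m^{-1}\circ f\circ m$ and $\beta=m^{-1}(\alpha)$. Then $G_\infty(f,\alpha)$ is abelian if and only if $c=0$ and one of the following holds: $(f,\alpha)$ is $\overline{K}$-conjugate to $(x^d,0)$ (given $c=0$, this just means $\alpha=0$); or $(f,\alpha)$ is $K^{\mathrm{ab}}$-conjugate to $(x^d,\zeta)$ for some root of unity $\zeta\in\overline K$. In particular, if $a=1$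 and $G_\infty(f,\alpha)$ is abelian, then $c=0$ and $\alpha$ is either $0$ or a root of unity. -/

import Mathlib

open Polynomial

namespace Arboreal

noncomputable section

/-- The backward orbit `T_∞(f, α)`: all `β` in the fixed algebraic closure of `K` with
`fⁿ(β) = α` for some `n ≥ 0`. -/
def tree {K : Type*} [Field K] (f : K[X]) (α : K) : Set (AlgebraicClosure K) :=
  {β | ∃ n : ℕ, (fun x : AlgebraicClosure K => aeval x f)^[n] β
    = algebraMap K (AlgebraicClosure K) α}

/-- The arboreal field `K_∞(f, α) = K(T_∞(f, α))`. -/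
def arborealField {K : Type*} [Field K] (f : K[X]) (α : K) :
    IntermediateField K (AlgebraicClosure K) :=
  IntermediateField.adjoin K (tree f α)

/-- The dynamical Galois group `G_∞(f, α) = Gal(K_∞(f, α)/K)`. -/
abbrev dynGal {K : Type*} [Field K] (f : K[X]) (α : K) : Type _ :=
  arborealField f α ≃ₐ[K] arborealField f α

/-- The maximal abelian extension `K^ab` of `K` inside the fixed algebraic closure: the compositum
of all abelian Galois extensions of `K`. -/
def maxAbelian (K : Type*) [Field K] : IntermediateField K (AlgebraicClosure K) :=
  sSup {E | IsAbelianGalois K E}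

/-- The pairs `(f, α)` and `(g, β)` are `L`-conjugate: there is `m = u x + v` with `u, v ∈ L`,
`u ≠ 0`, such that `g = m⁻¹ ∘ f ∘ m` and `β = m⁻¹(α)`. -/
def IsConjugateOver {K : Type*} [Field K] (L : IntermediateField K (AlgebraicClosure K))
    (f : (AlgebraicClosure K)[X]) (α : AlgebraicClosure K)
    (g : (AlgebraicClosure K)[X]) (β : AlgebraicClosure K) : Prop :=
  ∃ u ∈ L, ∃ v ∈ L, u ≠ 0 ∧
    f.comp (C u * X + C v) = (C u * X + C v).comp g ∧
    (C u * X + C v).eval β = α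

end

end Arboreal

/-! The group is abelian exactly when automorphisms of the algebraic closure commute on the whole
tree, i.e. when the tree lies in `commutingField`, which is $K^{\mathrm{ab}}$. Scaling by $l$ with
$l^{d-1}=a$ makes the map monic. Factoring $y^d-s^d$ along the orbit of $0$ and using its
periodicity, every element of such a tree is a $d^m$-th power in an abelian extension for every $m$
(`exists_pow_eq_of_backward_closed`). A Kummer argument followed by Northcott finiteness then makes
each nonzero element a root of unity (`isOfFinOrder_of_forall_exists_root`). Averaging $|\xi^i
y-c|^2$ over the $d$-th roots of unity $\xi^i$ excludes $c\ne0$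
(`eq_zero_of_backward_closed_of_isOfFinOrder`). Conversely, a conjugate of $(x^d,\beta)$ has as tree
an affine image of the roots of $\beta$. -/

namespace Arboreal

/-- The elements of `Ω` on which any two automorphisms of `Ω / K` commute, that is, the fixed field
of the commutator subgroup of `Gal(Ω / K)`. -/
def commutingField (K Ω : Type*) [Field K] [Field Ω] [Algebra K Ω] : IntermediateField K Ω where
  carrier := {x | ∀ ρ τ : Ω ≃ₐ[K] Ω, ρ (τ x) = τ (ρ x)}
  mul_mem' hx hy ρ τ := by simp only [map_mul, hx ρ τ, hy ρ τ]
  add_mem' hx hy ρ τ := by simp only [map_add, hx ρ τ, hy ρ τ]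
  algebraMap_mem' r ρ τ := by simp
  inv_mem' x hx ρ τ := by simp only [map_inv₀, hx ρ τ]

section CommutingField

variable {K Ω : Type*} [Field K] [Field Ω] [Algebra K Ω]

theorem apply_mem_commutingField {x : Ω} (hx : x ∈ commutingField K Ω) (ρ : Ω ≃ₐ[K] Ω) :
    ρ x ∈ commutingField K Ω := fun σ τ => by
  calc σ (τ (ρ x)) = (τ * ρ) (σ x) := hx σ (τ * ρ)
    _ = τ (ρ (σ x)) := rfl
    _ = τ (σ (ρ x)) := by rw [hx ρ σ]

/-- Enlarging the base field enlarges the commuting field. -/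
theorem mem_commutingField_of_tower {E : IntermediateField K Ω} {x : Ω}
    (hx : x ∈ commutingField K Ω) : x ∈ commutingField E Ω := fun ρ τ =>
  hx (ρ.restrictScalars K) (τ.restrictScalars K)

/-- Roots of unity generate abelian extensions. -/
theorem mem_commutingField_of_isOfFinOrder {ζ : Ω} (h : IsOfFinOrder ζ) :
    ζ ∈ commutingField K Ω := by
  have key : ∀ ρ : Ω ≃ₐ[K] Ω, ∃ i : ℕ, ρ ζ = ζ ^ i := fun ρ => by
    have : NeZero (orderOf ζ) := ⟨h.orderOf_pos.ne'⟩
    obtain ⟨i, -, hi⟩ := (IsPrimitiveRoot.orderOf ζ).eq_pow_of_pow_eq_one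
      (ξ := ρ ζ) (by rw [← map_pow, pow_orderOf_eq_one, map_one])
    exact ⟨i, hi.symm⟩
  intro ρ τ
  obtain ⟨i, hi⟩ := key ρ
  obtain ⟨j, hj⟩ := key τ
  rw [hi, hj, map_pow, map_pow, hi, hj, ← pow_mul, ← pow_mul, mul_comm]

theorem normal_of_forall_apply_mem [Normal K Ω] {E : IntermediateField K Ω}
    (h : ∀ ρ : Ω ≃ₐ[K] Ω, ∀ x ∈ E, ρ x ∈ E) : Normal K E := by
  rw [IntermediateField.normal_iff_forall_map_le']
  rintro ρ _ ⟨x, hx, rfl⟩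
  exact h ρ x hx

/-- The Galois group of a normal subextension is commutative exactly when the subextension lies in
the commuting field. -/
theorem isMulCommutative_algEquiv_iff [Normal K Ω] (E : IntermediateField K Ω) [Normal K E] :
    IsMulCommutative (E ≃ₐ[K] E) ↔ E ≤ commutingField K Ω := by
  rw [isMulCommutative_iff]
  constructor
  · intro h x hx ρ τ
    have := congrArg (fun σ : E ≃ₐ[K] E => algebraMap E Ω (σ ⟨x, hx⟩))
      (h (ρ.restrictNormal E) (τ.restrictNormal E))
    simp only [AlgEquiv.mul_apply, AlgEquiv.restrictNormal_commutes] at this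
    exact this
  · intro h ρ τ
    ext x
    have := h x.2 (ρ.liftNormal Ω) (τ.liftNormal Ω)
    have hx (σ : E ≃ₐ[K] E) (y : E) : σ.liftNormal Ω (y : Ω) = (σ y : E) :=
      σ.liftNormal_commutes Ω y
    simp only [hx] at this
    exact this

end CommutingField

/-! ### Abelian dynamical Galois groups and $K^{\mathrm{ab}}$. -/

section MaxAbelian

variable {K : Type*} [Field K]

/-- The commuting field is itself normal with commutative group, hence one of the fields in the
compositum; perfectness supplies separability. -/
theorem maxAbelian_eq_commutingField [PerfectField K] :
    maxAbelian K = commutingField K (AlgebraicClosure K) := by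
  apply le_antisymm
  · refine sSup_le fun E (hE : IsAbelianGalois K E) => ?_
    exact (isMulCommutative_algEquiv_iff E).1 inferInstance
  · have hn : Normal K (commutingField K (AlgebraicClosure K)) :=
      normal_of_forall_apply_mem fun ρ x hx => apply_mem_commutingField hx ρ
    refine le_sSup (show IsAbelianGalois K _ from ?_)
    have := (isMulCommutative_algEquiv_iff (commutingField K (AlgebraicClosure K))).2 le_rfl
    have : IsGalois K (commutingField K (AlgebraicClosure K)) := ⟨⟩
    exact { }

theorem apply_mem_tree {f : K[X]} {α : K} {x : AlgebraicClosure K} (hx : x ∈ tree f α)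
    (ρ : AlgebraicClosure K ≃ₐ[K] AlgebraicClosure K) : ρ x ∈ tree f α := by
  obtain ⟨n, hn⟩ := hx
  refine ⟨n, ?_⟩
  have hsc : Function.Semiconj ρ (fun x : AlgebraicClosure K => aeval x f)
      (fun x : AlgebraicClosure K => aeval x f) := fun x => by
    simpa using (aeval_algHom_apply (ρ : AlgebraicClosure K →ₐ[K] AlgebraicClosure K) x f).symm
  rw [← (hsc.iterate_right n) x, hn, AlgEquiv.commutes]

theorem isMulCommutative_dynGal_iff {f : K[X]} {α : K} :
    IsMulCommutative (dynGal f α) ↔ tree f α ⊆ commutingField K (AlgebraicClosure K) := by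
  have : Normal K (arborealField f α) := normal_of_forall_apply_mem fun ρ x hx => by
    have : arborealField f α ≤ (arborealField f α).comap ρ.toAlgHom :=
      IntermediateField.adjoin_le_iff.2 fun y hy =>
        IntermediateField.subset_adjoin K _ (apply_mem_tree hy ρ)
    exact this hx
  rw [isMulCommutative_algEquiv_iff, arborealField, IntermediateField.adjoin_le_iff]

theorem mem_tree_of_aeval_mem {f : K[X]} {α : K} {x : AlgebraicClosure K}
    (hx : aeval x f ∈ tree f α) : x ∈ tree f α := by
  obtain ⟨n, hn⟩ := hx
  exact ⟨n + 1, hn⟩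

theorem algebraMap_mem_tree (f : K[X]) (α : K) :
    algebraMap K (AlgebraicClosure K) α ∈ tree f α := ⟨0, rfl⟩

end MaxAbelian

/-! ### Backward-closed sets of $x^d+c$. -/

/-- Let `T` be a backward-closed set for the map `x ↦ x ^ d + c`, contained in a subfield `A` with
all roots of unity, and let `0` be periodic. Then every element of `T` is infinitely `d`-divisible
in the multiplicative monoid of `A`. -/
theorem exists_pow_eq_of_backward_closed {Ω : Type*} [Field Ω] [IsAlgClosed Ω] [CharZero Ω]
    (A : Subfield Ω) (hA : ∀ ζ : Ω, IsOfFinOrder ζ → ζ ∈ A) {d : ℕ} (hd : 0 < d) {c : Ω}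
    (hper : (0 : Ω) ∈ Function.periodicPts (fun x : Ω => x ^ d + c)) {T : Set Ω}
    (hTA : T ⊆ A) (hT : ∀ y : Ω, y ^ d + c ∈ T → y ∈ T) (m : ℕ) :
    ∀ x ∈ T, ∃ w ∈ A, w ^ d ^ m = x := by
  have : NeZero (d : Ω) := ⟨Nat.cast_ne_zero.2 hd.ne'⟩
  obtain ⟨ξ, hξ⟩ := HasEnoughRootsOfUnity.exists_primitiveRoot Ω d
  induction m with
  | zero => exact fun x hx => ⟨x, hTA hx, by simp⟩
  | succ m ih =>
    -- The $d^{m+1}$-th powers from `A`. A submonoid suffices, and it allows the value $0$.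
    let P : Submonoid Ω := A.toSubmonoid.map (powMonoidHom (d ^ (m + 1)))
    have hroot : ∀ ζ : Ω, IsOfFinOrder ζ → ζ ∈ P := fun ζ hζ => by
      obtain ⟨w, hw⟩ := IsAlgClosed.exists_pow_nat_eq ζ (pow_pos hd (m + 1))
      exact ⟨w, hA w (.of_pow (hw ▸ hζ) (pow_pos hd (m + 1)).ne'), hw⟩
    -- The index `i + 1` starts the induction at $f(0)=c$, where $x-c=y^d$ with $y\in T$ already a
    -- $d^m$-th power.
    have key : ∀ i : ℕ, ∀ x ∈ T, x - (fun x : Ω => x ^ d + c)^[i + 1] 0 ∈ P := by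
      intro i
      induction i with
      | zero =>
        intro x hx
        obtain ⟨y, hy⟩ := IsAlgClosed.exists_pow_nat_eq (x - c) hd
        obtain ⟨w, hwA, hw⟩ := ih y (hT y (by rwa [hy, sub_add_cancel]))
        refine ⟨w, hwA, ?_⟩
        simp [powMonoidHom_apply, pow_succ, pow_mul, hw, hy, hd.ne']
      | succ i ihi =>
        intro x hx
        obtain ⟨y, hy⟩ := IsAlgClosed.exists_pow_nat_eq (x - c) hd
        set s := (fun x : Ω => x ^ d + c)^[i + 1] 0 with hs
        have hx' : x - (fun x : Ω => x ^ d + c)^[i + 1 + 1] 0 = y ^ d - s ^ d := by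
          rw [Function.iterate_succ_apply', ← hs, hy]; ring
        -- Each factor is $\zeta(\zeta^{-1}y-s)$, and $\zeta^{-1}y$ is another preimage of $x$, so
        -- the previous orbit point $s$ handles it.
        rw [hx', hξ.pow_sub_pow_eq_prod_sub_mul _ _ hd]
        refine Submonoid.prod_mem _ fun ζ hζ => ?_
        rw [mem_nthRootsFinset hd] at hζ
        have hζ0 : ζ ≠ 0 := fun h => by simp [h, hd.ne'] at hζ
        have : y - ζ * s = ζ * (ζ⁻¹ * y - s) := by field_simp
        rw [this]
        refine mul_mem (hroot ζ (isOfFinOrder_iff_pow_eq_one.2 ⟨d, hd, hζ⟩)) (ihi _ (hT _ ?_))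
        rwa [mul_pow, inv_pow, hζ, inv_one, one_mul, hy, sub_add_cancel]
    obtain ⟨n, hn, h0⟩ := hper
    intro x hx
    obtain ⟨n, rfl⟩ := Nat.exists_eq_succ_of_ne_zero hn.ne'
    have := key n x hx
    rw [show (fun x : Ω => x ^ d + c)^[n + 1] 0 = 0 from h0, sub_zero] at this
    exact this

/-- A nonempty backward-closed set for `x ↦ x ^ d + c` cannot consist of `0` and roots of unity
only, unless `c = 0`. -/
theorem eq_zero_of_backward_closed_of_isOfFinOrder {Ω : Type*} [Field Ω] [IsAlgClosed Ω]
    [CharZero Ω] (φ : Ω →+* ℂ) {d : ℕ} (hd : 2 ≤ d) {c : Ω} {T : Set Ω} (hne : T.Nonempty)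
    (hT : ∀ y : Ω, y ^ d + c ∈ T → y ∈ T) (hfin : ∀ x ∈ T, x = 0 ∨ IsOfFinOrder x) : c = 0 := by
  have hd0 : 0 < d := by omega
  have : NeZero (d : Ω) := ⟨Nat.cast_ne_zero.2 hd0.ne'⟩
  obtain ⟨ξ, hξ⟩ := HasEnoughRootsOfUnity.exists_primitiveRoot Ω d
  by_contra hc
  have hpre : ∀ x ∈ T, ∃ y ∈ T, y ^ d + c = x := fun x hx => by
    obtain ⟨y, hy⟩ := IsAlgClosed.exists_pow_nat_eq (x - c) hd0
    exact ⟨y, hT y (by rwa [hy, sub_add_cancel]), by rw [hy, sub_add_cancel]⟩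
  -- Having the image of $y$ in `T` puts every $\xi^i y$ in `T`. If the first candidate is $0$, its
  -- preimage is nonzero because $c\ne0$.
  obtain ⟨y, hyT, hy0, hyf⟩ : ∃ y ∈ T, y ≠ 0 ∧ y ^ d + c ∈ T := by
    obtain ⟨x, hx⟩ := hne
    obtain ⟨y, hy, rfl⟩ := hpre x hx
    obtain ⟨z, hz, rfl⟩ := hpre y hy
    rcases eq_or_ne (z ^ d + c) 0 with h | h
    · refine ⟨z, hz, fun h0 => hc ?_, hy⟩
      simpa [h0, hd0.ne'] using h
    · exact ⟨_, hy, h, hx⟩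
  have hunit : ∀ x : Ω, IsOfFinOrder x → Complex.normSq (φ x) = 1 := fun x hx => by
    have h1 : ‖φ x‖ = 1 := (φ.toMonoidHom.isOfFinOrder hx).norm_eq_one
    rw [Complex.normSq_eq_norm_sq, h1, one_pow]
  have hle : ∀ x ∈ T, Complex.normSq (φ x) ≤ 1 := fun x hx => by
    rcases hfin x hx with rfl | h
    · simp
    · exact (hunit x h).le
  have hy1 : Complex.normSq (φ y) = 1 := hunit y ((hfin y hyT).resolve_left hy0)
  have hξ1 : Complex.normSq (φ ξ) = 1 :=
    hunit ξ (isOfFinOrder_iff_pow_eq_one.2 ⟨d, hd0, hξ.pow_eq_one⟩)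
  have hterm : ∀ i : ℕ, Complex.normSq (φ (ξ ^ i * y) - φ c) ≤ 1 := fun i => by
    have hmem : ξ ^ i * y ∈ T := hT _ (by
      rwa [mul_pow, ← pow_mul, mul_comm i, pow_mul, hξ.pow_eq_one, one_pow, one_mul])
    obtain ⟨z, hz, hzy⟩ := hpre _ hmem
    rw [← hzy, ← map_sub, add_sub_cancel_right, map_pow, map_pow]
    exact pow_le_one₀ (Complex.normSq_nonneg _) (hle z hz)
  -- The cross terms cancel since the $d$-th roots of unity sum to $0$. The mean $1+|c|^2$ then
  -- contradicts the termwise bound $1$.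
  have hsum : ∑ i ∈ Finset.range d, Complex.normSq (φ (ξ ^ i * y) - φ c)
      = d * (1 + Complex.normSq (φ c)) := by
    have hzero : ∑ i ∈ Finset.range d, (φ (ξ ^ i * y) * (starRingEnd ℂ) (φ c)).re = 0 := by
      rw [← Complex.re_sum, ← Finset.sum_mul, ← map_sum, ← Finset.sum_mul,
        hξ.geom_sum_eq_zero (by omega)]
      simp
    simp only [Complex.normSq_sub]
    rw [Finset.sum_sub_distrib, ← Finset.mul_sum, hzero]
    simp [hy1, hξ1, mul_add]
  have hbound : ∑ i ∈ Finset.range d, Complex.normSq (φ (ξ ^ i * y) - φ c) ≤ d :=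
    (Finset.sum_le_sum fun i _ => hterm i).trans (by simp)
  rw [hsum] at hbound
  have hcpos : 0 < Complex.normSq (φ c) := Complex.normSq_pos.2 (by simpa using hc)
  have hdpos : (0 : ℝ) < d := by exact_mod_cast hd0
  nlinarith [mul_pos hdpos hcpos]

/-! ### Kummer theory and Northcott finiteness over number fields. -/

/-- In an algebraic closure of a number field, some fixed power of every Galois action on roots of
unity is realized over the number field. -/
theorem exists_algEquiv_apply_eq_pow (K Ω : Type*) [Field K] [NumberField K] [Field Ω] [Algebra K Ω]
    [IsAlgClosure K Ω] : ∃ D : ℕ, 0 < D ∧ ∀ N g : ℕ, 0 < N → g.Coprime N →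
      ∃ τ : Ω ≃ₐ[K] Ω, ∀ ζ : Ω, ζ ^ N = 1 → τ ζ = ζ ^ g ^ D := by
  have : CharZero Ω := charZero_of_injective_algebraMap (algebraMap K Ω).injective
  have : IsAlgClosed Ω := IsAlgClosure.isAlgClosed K
  have : Algebra.IsAlgebraic K Ω := IsAlgClosure.isAlgebraic
  have : Algebra.IsAlgebraic ℚ Ω := Algebra.IsAlgebraic.trans ℚ K Ω
  have : IsAlgClosure ℚ Ω := ⟨inferInstance, inferInstance⟩
  have : Normal ℚ Ω := IsAlgClosure.normal ℚ Ω
  -- A cyclotomic automorphism over $\mathbb Q$ may move `K`. As `K` has only $[K:\mathbb Q]$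
  -- embeddings, some power with exponent at most $[K:\mathbb Q]$ fixes `K`; the factorial is a
  -- multiple of every such exponent, independently of `N` and `g`.
  refine ⟨(Module.finrank ℚ K).factorial, Nat.factorial_pos _, fun N g hN hg => ?_⟩
  have : NeZero (N : Ω) := ⟨Nat.cast_ne_zero.2 hN.ne'⟩
  have : NeZero N := ⟨hN.ne'⟩
  obtain ⟨ξ, hξ⟩ := HasEnoughRootsOfUnity.exists_primitiveRoot Ω N
  obtain ⟨σ, hσ⟩ : ∃ σ : Ω ≃ₐ[ℚ] Ω, σ ξ = ξ ^ g := by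
    refine isConjRoot_iff_exists_algEquiv.1 ?_
    have h1 := hξ.isIntegral hN
    rw [IsConjRoot, minpoly.isIntegrallyClosed_eq_field_fractions' ℚ (h1.pow g),
      minpoly.isIntegrallyClosed_eq_field_fractions' ℚ h1, hξ.minpoly_eq_pow_coprime hg]
  have hσζ : ∀ ζ : Ω, ζ ^ N = 1 → σ ζ = ζ ^ g := fun ζ hζ => by
    obtain ⟨i, -, rfl⟩ := hξ.eq_pow_of_pow_eq_one hζ
    rw [map_pow, hσ, ← pow_mul, ← pow_mul, mul_comm]
  have hiter : ∀ n : ℕ, ∀ ζ : Ω, ζ ^ N = 1 → (σ ^ n) ζ = ζ ^ g ^ n := fun n => by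
    induction n with
    | zero => intro ζ _; simp
    | succ n ih =>
      intro ζ hζ
      rw [pow_succ, AlgEquiv.mul_apply, hσζ ζ hζ, map_pow, ih ζ hζ, ← pow_mul, pow_succ]
  obtain ⟨e, he0, hele, he⟩ : ∃ e : ℕ, 0 < e ∧ e ≤ Module.finrank ℚ K ∧
      ∀ k : K, (σ ^ e) (algebraMap K Ω k) = algebraMap K Ω k := by
    let r : Fin (Module.finrank ℚ K + 1) → (K →ₐ[ℚ] Ω) := fun i =>
      ((σ ^ (i : ℕ) : Ω ≃ₐ[ℚ] Ω) : Ω →ₐ[ℚ] Ω).comp (IsScalarTower.toAlgHom ℚ K Ω)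
    obtain ⟨i, j, hij, hr⟩ := Fintype.exists_ne_map_eq_of_card_lt r (by
      rw [AlgHom.card, Fintype.card_fin]; exact Nat.lt_succ_self _)
    wlog hlt : i < j generalizing i j
    · exact this j i hij.symm hr.symm (lt_of_le_of_ne (not_lt.1 hlt) hij.symm)
    have hlt' : (i : ℕ) < j := hlt
    refine ⟨j - i, by omega, by omega, fun k => (σ ^ (i : ℕ)).injective ?_⟩
    have := DFunLike.congr_fun hr k
    rw [← AlgEquiv.mul_apply, ← pow_add, Nat.add_sub_cancel' hlt'.le]
    exact this.symm
  have hfix : ∀ k : K, (σ ^ (Module.finrank ℚ K).factorial) (algebraMap K Ω k)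
      = algebraMap K Ω k := fun k => by
    obtain ⟨q, hq⟩ := Nat.dvd_factorial he0 hele
    rw [hq, pow_mul]
    clear hq
    induction q with
    | zero => simp
    | succ q ih => rw [pow_succ, AlgEquiv.mul_apply, he, ih]
  exact ⟨AlgEquiv.ofRingEquiv (f := (σ ^ (Module.finrank ℚ K).factorial).toRingEquiv) hfix,
    fun ζ hζ => hiter _ ζ hζ⟩

/-- If an `N`-th root of `x ∈ K` commutes with Galois and some automorphism raises `N`-th roots of
unity to the power `g`, then `x ^ (g - 1)` is an `N`-th power in `K`. -/
theorem exists_pow_eq_pow_sub_one {K Ω : Type*} [Field K] [CharZero K] [Field Ω] [Algebra K Ω]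
    [IsAlgClosure K Ω] {N g : ℕ} (hg : 1 ≤ g) {x : K} (hx : x ≠ 0) {z : Ω}
    (hz : z ^ N = algebraMap K Ω x) (hzc : z ∈ commutingField K Ω) (hN : 0 < N) (τ : Ω ≃ₐ[K] Ω)
    (hτ : ∀ ζ : Ω, ζ ^ N = 1 → τ ζ = ζ ^ g) : ∃ y : K, y ^ N = x ^ (g - 1) := by
  have : IsGalois K Ω := IsAlgClosure.isGalois K Ω
  have hx0 : algebraMap K Ω x ≠ 0 := by simpa using hx
  have hz0 : z ≠ 0 := fun h => hx0 (by rw [← hz, h, zero_pow hN.ne'])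
  have hτz : τ z ≠ 0 := by simpa using hz0
  -- If $\sigma z=\zeta z$, commutation gives $\sigma(\tau z)=\zeta^g\,\tau z$, so $z^g/\tau z$ is
  -- Galois-invariant. Its $N$-th power is $x^g/x$.
  obtain ⟨y, hy⟩ := (InfiniteGalois.mem_range_algebraMap_iff_fixed (k := K) (z ^ g / τ z)).2 <| by
    intro σ
    have hζ : (σ z / z) ^ N = 1 := by
      rw [div_pow, ← map_pow, hz, AlgEquiv.commutes, div_self hx0]
    have h1 : σ z = (σ z / z) * z := (div_mul_cancel₀ _ hz0).symm
    have hζ0 : σ z / z ≠ 0 := div_ne_zero (by simpa using hz0) hz0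
    rw [map_div₀, map_pow, hzc σ τ, h1, map_mul τ, hτ _ hζ, mul_pow, mul_div_mul_left]
    exact pow_ne_zero _ hζ0
  refine ⟨y, (algebraMap K Ω).injective ?_⟩
  obtain ⟨k, rfl⟩ := Nat.exists_eq_add_of_le' hg
  rw [map_pow, hy, div_pow, ← map_pow, hz, AlgEquiv.commutes, ← pow_mul, mul_comm, pow_mul, hz,
    pow_succ, mul_div_cancel_right₀ _ hx0, Nat.add_sub_cancel, map_pow]

/-- The exponent is an integer divisible by every $d^m$, and some $d^m$ exceeds its absolute value.
This forces all finite valuations of an infinitely divisible element to be trivial. -/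
theorem eq_one_of_forall_pow_eq {d : ℕ} (hd : 2 ≤ d) {γ : WithZero (Multiplicative ℤ)} (hγ : γ ≠ 0)
    (h : ∀ m : ℕ, ∃ δ : WithZero (Multiplicative ℤ), δ ^ d ^ m = γ) : γ = 1 := by
  obtain ⟨a, rfl⟩ := WithZero.ne_zero_iff_exists.1 hγ
  obtain ⟨m, hm⟩ : ∃ m : ℕ, (Multiplicative.toAdd a).natAbs < d ^ m :=
    ⟨_, Nat.lt_pow_self (by omega)⟩
  obtain ⟨δ, hδ⟩ := h m
  have hpos : d ^ m ≠ 0 := (pow_pos (by omega) m).ne'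
  obtain ⟨b, rfl⟩ := WithZero.ne_zero_iff_exists.1 (show δ ≠ 0 from fun h0 => hγ (by
    rw [← hδ, h0, zero_pow hpos]))
  rw [← WithZero.coe_pow, WithZero.coe_inj] at hδ
  have hdvd : ((d ^ m : ℕ) : ℤ) ∣ Multiplicative.toAdd a :=
    ⟨Multiplicative.toAdd b, by rw [← hδ, toAdd_pow, nsmul_eq_mul]⟩
  have h0 : Multiplicative.toAdd a = 0 := Int.eq_zero_of_abs_lt_dvd hdvd (by
    rw [Int.abs_eq_natAbs]; exact_mod_cast hm)
  rw [toAdd_eq_zero.1 h0, WithZero.coe_one]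

/-- An infinitely `d`-divisible element of the multiplicative group of a number field is a root of
unity. -/
theorem isOfFinOrder_of_forall_exists_pow_eq {K : Type*} [Field K] [NumberField K] {d : ℕ}
    (hd : 2 ≤ d) {x : K} (hx : x ≠ 0) (h : ∀ m : ℕ, ∃ y : K, y ^ d ^ m = x) : IsOfFinOrder x := by
  have hint : IsIntegral ℤ x := by
    obtain ⟨y, hy⟩ := IsDedekindDomain.HeightOneSpectrum.mem_integers_of_valuation_le_one
      (R := NumberField.RingOfIntegers K) K x fun v => by
        refine (eq_one_of_forall_pow_eq hd ((Valuation.ne_zero_iff _).2 hx) fun m => ?_).le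
        obtain ⟨y, hy⟩ := h m
        exact ⟨v.valuation K y, by rw [← map_pow, hy]⟩
    exact hy ▸ y.2
  choose y hy using h
  obtain ⟨B, hB⟩ : ∃ B : ℝ, ∀ φ : K →+* ℂ, ‖φ x‖ ≤ B := by
    obtain ⟨B, hB⟩ := (Set.finite_range fun φ : K →+* ℂ => ‖φ x‖).bddAbove
    exact ⟨B, fun φ => hB ⟨φ, rfl⟩⟩
  have hpos : ∀ m, d ^ m ≠ 0 := fun m => (pow_pos (by omega) m).ne'
  -- The roots $y_m$ are integral with uniformly bounded conjugates, so only finitely many values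
  -- occur and two of them coincide.
  have hmem : ∀ m, y m ∈ {x : K | IsIntegral ℤ x ∧ ∀ φ : K →+* ℂ, ‖φ x‖ ≤ max B 1} := fun m => by
    refine ⟨.of_pow (Nat.pos_of_ne_zero (hpos m)) (hy m ▸ hint), fun φ => ?_⟩
    by_contra! hlt
    have h1 : 1 ≤ ‖φ (y m)‖ := (le_max_right _ _).trans hlt.le
    have h2 : ‖φ (y m)‖ ≤ ‖φ x‖ := by
      rw [← hy m, map_pow, norm_pow]
      exact le_self_pow₀ h1 (hpos m)
    exact absurd (h2.trans ((hB φ).trans (le_max_left _ _))) (not_le.2 hlt)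
  obtain ⟨i, j, hij, heq⟩ : ∃ i j, i < j ∧ y i = y j := by
    obtain ⟨i, -, j, -, hij, heq⟩ := Set.infinite_univ.exists_lt_map_eq_of_mapsTo
      (fun m _ => hmem m) (NumberField.Embeddings.finite_of_norm_le K ℂ (max B 1))
    exact ⟨i, j, hij, heq⟩
  obtain ⟨k, rfl⟩ := Nat.exists_eq_add_of_lt hij
  have hpow : x ^ d ^ (k + 1) = x := by
    rw [← hy i, ← pow_mul, ← pow_add, heq, ← add_assoc, hy, ← hy i, heq]
  have h2 : 2 ≤ d ^ (k + 1) := hd.trans (Nat.le_self_pow (by omega) d)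
  refine isOfFinOrder_iff_pow_eq_one.2 ⟨d ^ (k + 1) - 1, by omega, mul_right_cancel₀ hx ?_⟩
  rw [← pow_succ, Nat.sub_add_cancel (by omega), hpow, one_mul]

/-- An element of a number field all of whose `d ^ m`-th roots generate abelian extensions is a
root of unity. -/
theorem isOfFinOrder_of_forall_exists_root {K Ω : Type*} [Field K] [NumberField K] [Field Ω]
    [Algebra K Ω] [IsAlgClosure K Ω] {d : ℕ} (hd : 2 ≤ d) {x : K} (hx : x ≠ 0)
    (h : ∀ m : ℕ, ∃ z ∈ commutingField K Ω, z ^ d ^ m = algebraMap K Ω x) : IsOfFinOrder x := by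
  obtain ⟨D, hD, hτ⟩ := exists_algEquiv_apply_eq_pow K Ω
  -- The choice $g=d+1$ is coprime to every $d^m$, so one exponent $(d+1)^D-1>0$ serves all $m$ at
  -- once.
  have h1 : 2 ≤ (d + 1) ^ D := le_trans (by omega) (Nat.le_self_pow hD.ne' (d + 1))
  refine .of_pow (n := (d + 1) ^ D - 1) ?_ (by omega)
  refine isOfFinOrder_of_forall_exists_pow_eq hd (pow_ne_zero _ hx) fun m => ?_
  obtain ⟨z, hzc, hz⟩ := h m
  have hN : 0 < d ^ m := pow_pos (by omega) m
  obtain ⟨τ, hτm⟩ := hτ (d ^ m) (d + 1) hN (Nat.Coprime.pow_right m (by simp))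
  exact exists_pow_eq_pow_sub_one (by omega) hx hz hzc hN τ hτm

/-! ### The tree of $ax^d+c$ and its monic normalization. -/

section Unicritical

variable {K : Type*} [Field K] {d : ℕ} {a c α : K} {l : AlgebraicClosure K}

theorem aeval_unicritical (x : AlgebraicClosure K) :
    aeval x (C a * X ^ d + C c : K[X])
      = algebraMap K (AlgebraicClosure K) a * x ^ d + algebraMap K (AlgebraicClosure K) c := by
  simp

/-- If `l ^ (d - 1) = a`, then `x ↦ l * x` conjugates `a x ^ d + c` to `x ^ d + l * c`. -/
theorem semiconj_unicritical (hd : 1 ≤ d) (hl : l ^ (d - 1) = algebraMap K _ a) :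
    Function.Semiconj (fun x => l * x)
      (fun x : AlgebraicClosure K => aeval x (C a * X ^ d + C c : K[X]))
      (fun x => x ^ d + l * algebraMap K _ c) := fun x => by
  simp only [aeval_unicritical]
  rw [mul_pow, ← hl, ← Nat.sub_add_cancel hd, pow_succ l, Nat.sub_add_cancel hd]
  ring

theorem backward_closed_image_tree (hd : 1 ≤ d) (hl : l ^ (d - 1) = algebraMap K _ a)
    (hl0 : l ≠ 0) (y : AlgebraicClosure K)
    (hy : y ^ d + l * algebraMap K _ c ∈ (fun x => l * x) '' tree (C a * X ^ d + C c) α) :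
    y ∈ (fun x => l * x) '' tree (C a * X ^ d + C c) α := by
  obtain ⟨x, hx, hxy⟩ := hy
  refine ⟨l⁻¹ * y, mem_tree_of_aeval_mem ?_, mul_inv_cancel_left₀ hl0 y⟩
  have := semiconj_unicritical (c := c) hd hl (l⁻¹ * y)
  simp only [mul_inv_cancel_left₀ hl0] at this hxy
  rw [← hxy] at this
  rwa [mul_left_cancel₀ hl0 this]

theorem zero_mem_periodicPts_of_eval (hd : 1 ≤ d) (hl : l ^ (d - 1) = algebraMap K _ a)
    (hper : (0 : K) ∈ Function.periodicPts fun x : K => (C a * X ^ d + C c : K[X]).eval x) :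
    (0 : AlgebraicClosure K) ∈ Function.periodicPts fun x => x ^ d + l * algebraMap K _ c := by
  obtain ⟨n, hn, h0⟩ := hper
  refine ⟨n, hn, ?_⟩
  have h1 : Function.Semiconj (algebraMap K (AlgebraicClosure K))
      (fun x : K => (C a * X ^ d + C c : K[X]).eval x)
      (fun x : AlgebraicClosure K => aeval x (C a * X ^ d + C c : K[X])) := fun x => by simp
  have h2 := (semiconj_unicritical (c := c) hd hl).comp_left h1
  have h3 := h2.iterate_right n 0
  rw [show (fun x : K => (C a * X ^ d + C c : K[X]).eval x)^[n] 0 = 0 from h0] at h3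
  simpa [Function.IsPeriodicPt, Function.IsFixedPt] using h3.symm

/-- If the dynamical Galois group is abelian and `0` is periodic, then after normalizing
`a x ^ d + c` to be monic the backward orbit consists of `0` and roots of unity. -/
theorem eq_zero_or_isOfFinOrder_of_mem_tree [NumberField K] (hd : 2 ≤ d)
    (hl : l ^ (d - 1) = algebraMap K _ a) (hl0 : l ≠ 0)
    (hper : (0 : K) ∈ Function.periodicPts fun x : K => (C a * X ^ d + C c : K[X]).eval x)
    (htree : tree (C a * X ^ d + C c) α ⊆ commutingField K (AlgebraicClosure K))
    {x : AlgebraicClosure K} (hx : x ∈ tree (C a * X ^ d + C c) α) :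
    l * x = 0 ∨ IsOfFinOrder (l * x) := by
  refine or_iff_not_imp_left.2 fun hlx => ?_
  -- The scalar `l` need not be abelian over `K`. Adjoining `l` and `x` to the base keeps a number
  -- field, over which the scaled tree still lies in the commuting field and $lx$ is rational.
  let E : IntermediateField K (AlgebraicClosure K) := IntermediateField.adjoin K {l, x}
  have hlE : l ∈ E := IntermediateField.subset_adjoin K _ (by simp)
  have hxE : x ∈ E := IntermediateField.subset_adjoin K _ (by simp)
  have : FiniteDimensional K E := IntermediateField.finiteDimensional_adjoin
    fun z _ => Algebra.IsIntegral.isIntegral z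
  have : NumberField E := NumberField.of_module_finite K E
  have : Algebra.IsAlgebraic E (AlgebraicClosure K) := Algebra.IsAlgebraic.tower_top (K := K) E
  have : IsAlgClosure E (AlgebraicClosure K) := ⟨inferInstance, inferInstance⟩
  have hTA : (fun x => l * x) '' tree (C a * X ^ d + C c) α ⊆
      (commutingField E (AlgebraicClosure K)).toSubfield := by
    rintro _ ⟨z, hz, rfl⟩
    exact mul_mem ((commutingField E (AlgebraicClosure K)).algebraMap_mem ⟨l, hlE⟩)
      (mem_commutingField_of_tower (htree hz))
  have hroots := fun m => exists_pow_eq_of_backward_closed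
    (commutingField E (AlgebraicClosure K)).toSubfield
    (fun ζ hζ => mem_commutingField_of_isOfFinOrder hζ) (by omega)
    (zero_mem_periodicPts_of_eval (by omega) hl hper) hTA
    (backward_closed_image_tree (by omega) hl hl0) m (l * x) ⟨x, hx, rfl⟩
  have hfin : IsOfFinOrder (⟨l * x, mul_mem hlE hxE⟩ : E) :=
    isOfFinOrder_of_forall_exists_root (Ω := AlgebraicClosure K) hd
      (fun h => hlx (congrArg Subtype.val h)) hroots
  exact (algebraMap E (AlgebraicClosure K)).toMonoidHom.isOfFinOrder hfin

theorem eq_zero_of_tree_subset_commutingField [NumberField K] (hd : 2 ≤ d) (ha : a ≠ 0)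
    (hper : (0 : K) ∈ Function.periodicPts fun x : K => (C a * X ^ d + C c : K[X]).eval x)
    (htree : tree (C a * X ^ d + C c) α ⊆ commutingField K (AlgebraicClosure K)) : c = 0 := by
  obtain ⟨l, hl⟩ := IsAlgClosed.exists_pow_nat_eq (algebraMap K (AlgebraicClosure K) a)
    (show 0 < d - 1 by omega)
  have hl0 : l ≠ 0 := fun h => ha <| by
    rw [h, zero_pow (by omega)] at hl
    simpa using hl.symm
  have : CharZero (AlgebraicClosure K) :=
    charZero_of_injective_algebraMap (algebraMap K (AlgebraicClosure K)).injective
  have : Algebra.IsAlgebraic ℚ (AlgebraicClosure K) := Algebra.IsAlgebraic.trans ℚ K _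
  let φ : AlgebraicClosure K →ₐ[ℚ] ℂ := IsAlgClosed.lift
  have := eq_zero_of_backward_closed_of_isOfFinOrder (φ : AlgebraicClosure K →+* ℂ) hd
    (Set.Nonempty.image _ ⟨_, algebraMap_mem_tree _ α⟩)
    (backward_closed_image_tree (c := c) (by omega) hl hl0) (by
      rintro _ ⟨x, hx, rfl⟩
      exact eq_zero_or_isOfFinOrder_of_mem_tree hd hl hl0 hper htree hx)
  simpa [hl0] using this

/-- The backward orbit of a pair conjugate to `(x ^ d, β)` is the image of the set of
`d ^ n`-th roots of `β`. -/
theorem exists_of_mem_tree_of_isConjugateOver {f : K[X]}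
    {L : IntermediateField K (AlgebraicClosure K)} {β : AlgebraicClosure K}
    (h : IsConjugateOver L (f.map (algebraMap K (AlgebraicClosure K))) (algebraMap K _ α)
      (X ^ d) β) :
    ∃ u ∈ L, ∃ v ∈ L, u * β + v = algebraMap K _ α ∧
      ∀ x ∈ tree f α, ∃ (n : ℕ) (w : AlgebraicClosure K), w ^ d ^ n = β ∧ x = u * w + v := by
  obtain ⟨u, hu, v, hv, hu0, hcomp, hβ⟩ := h
  simp only [eval_add, eval_mul, eval_C, eval_X] at hβ
  refine ⟨u, hu, v, hv, hβ, ?_⟩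
  rintro x ⟨n, hn⟩
  have hs : Function.Semiconj (fun w => u * w + v) (fun w : AlgebraicClosure K => w ^ d)
      (fun x : AlgebraicClosure K => aeval x f) := fun w => by
    have := congrArg (Polynomial.eval w) hcomp
    simpa [eval_map_algebraMap] using this.symm
  refine ⟨n, u⁻¹ * (x - v), ?_, by field_simp; ring⟩
  have h1 := hs.iterate_right n (u⁻¹ * (x - v))
  rw [pow_iterate] at h1
  simp only [mul_inv_cancel_left₀ hu0, sub_add_cancel, hn, ← hβ] at h1
  exact mul_left_cancel₀ hu0 (add_right_cancel h1)

theorem isConjugateOver_of_pow_eq {L : IntermediateField K (AlgebraicClosure K)}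
    {u β : AlgebraicClosure K} (hu : u ∈ L) (hu0 : u ≠ 0)
    (h : algebraMap K _ a * u ^ d = u) (hβ : u * β = algebraMap K _ α) :
    IsConjugateOver L ((C a * X ^ d + C 0 : K[X]).map (algebraMap K (AlgebraicClosure K)))
      (algebraMap K _ α) (X ^ d) β := by
  refine ⟨u, hu, 0, zero_mem L, hu0, ?_, by simpa using hβ⟩
  simp only [map_zero, add_zero, Polynomial.map_mul, map_C, Polynomial.map_pow, map_X, mul_comp,
    C_comp, X_comp, pow_comp, mul_pow]
  rw [← mul_assoc, ← C_pow, ← C_mul, h]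

end Unicritical

end Arboreal

open Arboreal

/-! ### The classification. -/

theorem theorem1p2 {K : Type*} [Field K] [NumberField K] (d : ℕ) (hd : 2 ≤ d)
    (a c α : K) (ha : a ≠ 0) (f : K[X]) (hf : f = C a * X ^ d + C c)
    (hper : (0 : K) ∈ Function.periodicPts (fun x : K => f.eval x)) :
    (IsMulCommutative (Arboreal.dynGal f α) ↔
      c = 0 ∧
        (Arboreal.IsConjugateOver ⊤
            (f.map (algebraMap K (AlgebraicClosure K))) (algebraMap K (AlgebraicClosure K) α)
            (X ^ d) 0 ∨
          ∃ ζ : AlgebraicClosure K, IsOfFinOrder ζ ∧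
            Arboreal.IsConjugateOver (Arboreal.maxAbelian K)
              (f.map (algebraMap K (AlgebraicClosure K))) (algebraMap K (AlgebraicClosure K) α)
              (X ^ d) ζ)) ∧
    (a = 1 → IsMulCommutative (Arboreal.dynGal f α) →
      c = 0 ∧ (α = 0 ∨ IsOfFinOrder α)) := by
  subst hf
  have hd0 : 0 < d := by omega
  rw [isMulCommutative_dynGal_iff, maxAbelian_eq_commutingField]
  refine ⟨⟨fun htree => ?_, ?_⟩, ?_⟩
  · obtain rfl := eq_zero_of_tree_subset_commutingField hd ha hper htree
    refine ⟨rfl, ?_⟩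
    obtain ⟨l, hl⟩ := IsAlgClosed.exists_pow_nat_eq (algebraMap K (AlgebraicClosure K) a)
      (show 0 < d - 1 by omega)
    have hl0 : l ≠ 0 := fun h => ha <| by
      rw [h, zero_pow (by omega)] at hl
      simpa using hl.symm
    have hu : algebraMap K (AlgebraicClosure K) a * l⁻¹ ^ d = l⁻¹ := by
      rw [← hl]
      obtain ⟨k, rfl⟩ := Nat.exists_eq_add_of_le' hd
      simp only [Nat.add_succ_sub_one, inv_pow]
      field_simp
      ring
    rcases eq_zero_or_isOfFinOrder_of_mem_tree hd hl hl0 hper htree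
      (algebraMap_mem_tree _ α) with h | h
    · refine Or.inl (isConjugateOver_of_pow_eq (u := l⁻¹) trivial (inv_ne_zero hl0) hu ?_)
      rw [mul_zero, (mul_eq_zero.1 h).resolve_left hl0]
    · refine Or.inr ⟨_, h, isConjugateOver_of_pow_eq (u := l⁻¹) ?_ (inv_ne_zero hl0) hu
        (inv_mul_cancel_left₀ hl0 _)⟩
      have hα : algebraMap K (AlgebraicClosure K) α ≠ 0 := fun h0 => by
        obtain ⟨n, hn, h1⟩ := isOfFinOrder_iff_pow_eq_one.1 h
        simp [h0, hn.ne'] at h1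
      -- The conjugating scalar is abelian over `K` because it is the quotient of $\alpha\in K$ by
      -- the root of unity $l\alpha$.
      rw [show l⁻¹ = algebraMap K (AlgebraicClosure K) α / (l * algebraMap K _ α) by field_simp]
      exact div_mem ((commutingField K _).algebraMap_mem α) (mem_commutingField_of_isOfFinOrder h)
  · rintro ⟨-, h | ⟨ζ, hζ, h⟩⟩ x hx
    · obtain ⟨u, -, v, -, hα, hT⟩ := exists_of_mem_tree_of_isConjugateOver h
      obtain ⟨n, w, hw, rfl⟩ := hT x hx
      -- Every root of $0$ is $0$, so the tree collapses to the single point $\alpha$.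
      rw [eq_zero_of_pow_eq_zero hw, hα]
      exact (commutingField K _).algebraMap_mem α
    · obtain ⟨u, hu, v, hv, -, hT⟩ := exists_of_mem_tree_of_isConjugateOver h
      obtain ⟨n, w, hw, rfl⟩ := hT x hx
      exact add_mem (mul_mem hu (mem_commutingField_of_isOfFinOrder
        (.of_pow (hw ▸ hζ) (pow_pos hd0 n).ne'))) hv
  · rintro rfl htree
    refine ⟨eq_zero_of_tree_subset_commutingField hd ha hper htree, ?_⟩
    have := eq_zero_or_isOfFinOrder_of_mem_tree (l := 1) hd (by simp) one_ne_zero hper htree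
      (algebraMap_mem_tree _ α)
    rw [one_mul] at this
    refine this.imp (fun h => by simpa using h) fun h => ?_
    exact (Function.Injective.isOfFinOrder_iff
      (f := (algebraMap K (AlgebraicClosure K)).toMonoidHom) (algebraMap K _).injective).1 h
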